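/- Let $q$ be a positive integer and let $\kappa\in\{0,1,2,\dots\}\cup\{+\infty\}$. All sequences $(s_j)_{j=0}^{\kappa}$ below consist of complex $q\times q$ matrices (for $\kappa=+\infty$, $j$ runs through all non-negative integers, and $\infty-1=\infty-k=\infty$). $A^{\dagger}$ denotes the Moore–Penrose inverse of a matrix $A$. Let $\alpha\in\mathbb R$. **Transform.** If $\kappa\ge 1$, put $u_0:=s_0$, $u_j:=-\alpha s_{j-1}+s_j$ for $1\le j\le\kappa$, then $r_0:=u_0^{\dagger}$ and $r_j:=-u_0^{\dagger}\sum_{l=0}^{j-1}u_{j-l}r_l$ for $1\le j\le\kappa$. The first $\alpha$-Schur–Stieltjes transform of $(s_j)_{j=0}^{\kappa}$ is the sequence $(s_j^{[1,\alpha]})_{j=0}^{\kappa-1}$ with $s_j^{[1,\alpha]}:=-s_0\,r_{j+1}\,s_0$. The $0$-th transform is $s_j^{[0,\alpha]}:=s_j$ $(0\le j\le\kappa)$, and for $1\le k\le\kappa$ the $k$-th transform $(s_j^{[k,\alpha]})_{j=0}^{\kappa-k}$ is the first transform of the $(k-1)$-th transform $(s_j^{[k-1,\alpha]})_{j=0}^{\kappa-(k-1)}$.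 **Classes.** Write $H_n(s):=[s_{j+k}]_{j,k=0}^{n}$ for the block Hankel matrix, $a_j:=-\alpha s_j+s_{j+1}$, and $L_0(s):=s_0$, $L_n(s):=s_{2n}-[s_n,\dots,s_{2n-1}]\,H_{n-1}(s)^{\dagger}\,\mathrm{col}(s_n,\dots,s_{2n-1})$ for $n\ge1$. * $\mathcal K^{\ge}_{q,0,\alpha}$ is the set of all $(s_j)_{j=0}^{0}$ with $s_0$ non-negative Hermitian; $\mathcal K^{\ge}_{q,2n,\alpha}$ ($n\ge1$) is the set of all $(s_j)_{j=0}^{2n}$ such that $H_n(s)$ and $H_{n-1}(a)$ are non-negative Hermitian; $\mathcal K^{\ge}_{q,2n+1,\alpha}$ ($n\ge0$) is the set of all $(s_j)_{j=0}^{2n+1}$ such that $H_n(s)$ and $H_n(a)$ are non-negative Hermitian; $\mathcal K^{\ge}_{q,\infty,\alpha}$ is the set of all $(s_j)_{j=0}^{\infty}$ with $(s_j)_{j=0}^{m}\in\mathcal K^{\ge}_{q,m,\alpha}$ for all $m\ge0$. * $\mathcal K^{>}_{q,\kappa,\alpha}$ is defined in the same way, with "positive Hermitian" (i.e. positive definite)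 in place of "non-negative Hermitian". * For finite $m$, $\mathcal K^{\ge,e}_{q,m,\alpha}$ is the set of all $(s_j)_{j=0}^{m}$ for which there is a complex $q\times q$ matrix $s_{m+1}$ with $(s_j)_{j=0}^{m+1}\in\mathcal K^{\ge}_{q,m+1,\alpha}$; and $\mathcal K^{\ge,e}_{q,\infty,\alpha}:=\mathcal K^{\ge}_{q,\infty,\alpha}$. * $\mathcal K^{\ge,cd}_{q,2n,\alpha}$ is the set of all $(s_j)_{j=0}^{2n}\in\mathcal K^{\ge}_{q,2n,\alpha}$ with $L_n(s)=0$; $\mathcal K^{\ge,cd}_{q,2n+1,\alpha}$ is the set of all $(s_j)_{j=0}^{2n+1}\in\mathcal K^{\ge}_{q,2n+1,\alpha}$ with $L_n(a)=0$; $\mathcal K^{\ge,cd}_{q,\infty,\alpha}$ is the set of all $(s_j)_{j=0}^{\infty}\in\mathcal K^{\ge}_{q,\infty,\alpha}$ such that $(s_j)_{j=0}^{m}\in\mathcal K^{\ge,cd}_{q,m,\alpha}$ for some integer $m\ge0$. * For an integer $m$ with $0\le m\le\kappa$, $\mathcal K^{\ge,cd,m}_{q,\kappa,\alpha}$ is the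 set of all $(s_j)_{j=0}^{\kappa}\in\mathcal K^{\ge}_{q,\kappa,\alpha}$ with $(s_j)_{j=0}^{m}\in\mathcal K^{\ge,cd}_{q,m,\alpha}$. **Theorem.** Let $\alpha\in\mathbb R$, let $\kappa\in\{0,1,2,\dots\}\cup\{+\infty\}$, let $(s_j)_{j=0}^{\kappa}$ be a sequence of complex $q\times q$ matrices, and let $k$ be an integer with $0\le k\le\kappa$. Then: (a) If $(s_j)_{j=0}^{\kappa}\in\mathcal K^{\ge}_{q,\kappa,\alpha}$, then $(s_j^{[k,\alpha]})_{j=0}^{\kappa-k}\in\mathcal K^{\ge}_{q,\kappa-k,\alpha}$. (b) If $(s_j)_{j=0}^{\kappa}\in\mathcal K^{\ge,e}_{q,\kappa,\alpha}$, then $(s_j^{[k,\alpha]})_{j=0}^{\kappa-k}\in\mathcal K^{\ge,e}_{q,\kappa-k,\alpha}$. (c) If $(s_j)_{j=0}^{\kappa}\in\mathcal K^{>}_{q,\kappa,\alpha}$, then $(s_j^{[k,\alpha]})_{j=0}^{\kappa-k}\in\mathcal K^{>}_{q,\kappa-k,\alpha}$. (d) If $m$ is an integer with $0\le m\le\kappa$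 and $(s_j)_{j=0}^{\kappa}\in\mathcal K^{\ge,cd,m}_{q,\kappa,\alpha}$, then $(s_j^{[k,\alpha]})_{j=0}^{\kappa-k}\in\mathcal K^{\ge,cd,\max\{0,m-k\}}_{q,\kappa-k,\alpha}$. (e) If $(s_j)_{j=0}^{\kappa}\in\mathcal K^{\ge,cd}_{q,\kappa,\alpha}$, then $(s_j^{[k,\alpha]})_{j=0}^{\kappa-k}\in\mathcal K^{\ge,cd}_{q,\kappa-k,\alpha}$. -/

import Mathlib

namespace SchurStieltjes

open Matrix
open scoped ComplexOrder

/-! Throughout, a finite or infinite sequence `s_0, s_1, …, s_κ` with `κ : ℕ∞` is represented by a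
function on all of `ℕ`, of which only the values at indices `j ≤ κ` are ever relevant: a class of
sequences of length `κ` only looks at these values, and the `j`-th term of the `k`-th transform only
looks at the terms with index at most `j + k`. -/

section MoorePenrose

/-- The four Penrose equations: `X` is the Moore-Penrose inverse of `A`. -/
structure IsMoorePenrose {m n : Type*} [Fintype m] [Fintype n]
    (A : Matrix m n ℂ) (X : Matrix n m ℂ) : Prop where
  mul_mul_left : A * X * A = A
  mul_mul_right : X * A * X = X
  isHermitian_left : (A * X).IsHermitian
  isHermitian_right : (X * A).IsHermitian

theorem IsMoorePenrose.unique {m n : Type*} [Fintype m] [Fintype n]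
    {A : Matrix m n ℂ} {X Y : Matrix n m ℂ}
    (hX : IsMoorePenrose A X) (hY : IsMoorePenrose A Y) : X = Y := by
  have h1 : A * X = A * Y := by
    calc A * X = (A * X)ᴴ := hX.isHermitian_left.eq.symm
      _ = ((A * Y) * (A * X))ᴴ := by
          rw [← Matrix.mul_assoc (A * Y) A X, hY.mul_mul_left]
      _ = (A * X) * (A * Y) := by
          rw [conjTranspose_mul, hX.isHermitian_left.eq, hY.isHermitian_left.eq]
      _ = A * Y := by rw [← Matrix.mul_assoc (A * X) A Y, hX.mul_mul_left]
  have h2 : X * A = Y * A := by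
    calc X * A = (X * A)ᴴ := hX.isHermitian_right.eq.symm
      _ = ((X * A) * (Y * A))ᴴ := by
          rw [Matrix.mul_assoc X A (Y * A), ← Matrix.mul_assoc A Y A, hY.mul_mul_left]
      _ = (Y * A) * (X * A) := by
          rw [conjTranspose_mul, hX.isHermitian_right.eq, hY.isHermitian_right.eq]
      _ = Y * A := by
          rw [Matrix.mul_assoc Y A (X * A), ← Matrix.mul_assoc A X A, hX.mul_mul_left]
  calc X = X * A * X := hX.mul_mul_right.symm
    _ = Y * (A * X) := by rw [h2, Matrix.mul_assoc]
    _ = Y * A * Y := by rw [h1, Matrix.mul_assoc]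
    _ = Y := hY.mul_mul_right

theorem exists_isMoorePenrose_of_isHermitian {n : Type*} [Fintype n]
    {B : Matrix n n ℂ} (hB : B.IsHermitian) :
    ∃ X : Matrix n n ℂ, X.IsHermitian ∧ IsMoorePenrose B X := by
  classical
  obtain ⟨U, V, d, hVU, hV, hBd⟩ : ∃ (U V : Matrix n n ℂ) (d : n → ℝ), V * U = 1 ∧ V = Uᴴ ∧
      B = U * diagonal (fun i => (d i : ℂ)) * V := by
    refine ⟨(hB.eigenvectorUnitary : Matrix n n ℂ), star (hB.eigenvectorUnitary : Matrix n n ℂ),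
      hB.eigenvalues, by simp, rfl, ?_⟩
    have h := hB.spectral_theorem
    rw [Unitary.conjStarAlgAut_apply] at h
    exact h
  have key : ∀ a b : n → ℂ, (U * diagonal a * V) * (U * diagonal b * V)
      = U * diagonal (fun i => a i * b i) * V := by
    intro a b
    calc (U * diagonal a * V) * (U * diagonal b * V)
        = U * diagonal a * (V * U) * diagonal b * V := by simp only [Matrix.mul_assoc]
      _ = U * (diagonal a * diagonal b) * V := by
          rw [hVU, Matrix.mul_one]; simp only [Matrix.mul_assoc]
      _ = _ := by rw [diagonal_mul_diagonal]
  have herm : ∀ a : n → ℝ, (U * diagonal (fun i => (a i : ℂ)) * V).IsHermitian := by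
    intro a
    have hd : (diagonal (fun i => (a i : ℂ)))ᴴ = diagonal (fun i => (a i : ℂ)) := by
      rw [diagonal_conjTranspose]; congr 1; ext i; simp
    unfold Matrix.IsHermitian
    rw [conjTranspose_mul, conjTranspose_mul, hd, hV, conjTranspose_conjTranspose,
      Matrix.mul_assoc]
  refine ⟨U * diagonal (fun i => (((d i)⁻¹ : ℝ) : ℂ)) * V, herm _, ?_⟩
  subst hBd
  constructor
  · rw [key, key]; congr 3; ext i
    by_cases h : d i = 0 <;> simp [h]
  · rw [key, key]; congr 3; ext i
    by_cases h : d i = 0 <;> simp [h]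
  · rw [key]
    have := herm (fun i => d i * (d i)⁻¹)
    simpa using this
  · rw [key]
    have := herm (fun i => (d i)⁻¹ * d i)
    simpa using this

theorem exists_isMoorePenrose {m n : Type*} [Fintype m] [Fintype n] (A : Matrix m n ℂ) :
    ∃ X : Matrix n m ℂ, IsMoorePenrose A X := by
  classical
  obtain ⟨Y, hYh, hY⟩ := exists_isMoorePenrose_of_isHermitian (isHermitian_conjTranspose_mul_self A)
  have hA : A * (Y * (Aᴴ * A)) = A := by
    have h : Aᴴ * (A * (Y * (Aᴴ * A) - 1)) = 0 := by
      have := hY.mul_mul_left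
      rw [← Matrix.mul_assoc, Matrix.mul_sub, ← Matrix.mul_assoc, this, Matrix.mul_one, sub_self]
    rw [← Matrix.mul_assoc, conjTranspose_mul_self_mul_eq_zero, Matrix.mul_sub, Matrix.mul_one,
      sub_eq_zero] at h
    exact h
  refine ⟨Y * Aᴴ, ?_, ?_, ?_, ?_⟩
  · simpa only [Matrix.mul_assoc] using hA
  · have := hY.mul_mul_right
    calc Y * Aᴴ * A * (Y * Aᴴ) = (Y * (Aᴴ * A) * Y) * Aᴴ := by simp only [Matrix.mul_assoc]
      _ = Y * Aᴴ := by rw [this]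
  · unfold Matrix.IsHermitian
    rw [conjTranspose_mul, conjTranspose_mul, conjTranspose_conjTranspose, hYh.eq,
      Matrix.mul_assoc]
  · rw [Matrix.mul_assoc]
    exact hY.isHermitian_right

/-- The Moore-Penrose inverse `A⁺` of a complex matrix. -/
noncomputable def mpInv {m n : Type*} [Fintype m] [Fintype n] (A : Matrix m n ℂ) :
    Matrix n m ℂ :=
  (exists_isMoorePenrose A).choose

theorem mpInv_spec {m n : Type*} [Fintype m] [Fintype n] (A : Matrix m n ℂ) :
    IsMoorePenrose A (mpInv A) :=
  (exists_isMoorePenrose A).choose_spec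

end MoorePenrose

section Transform

/-- The reciprocal sequence: `s_0^♯ = s_0⁺` and
`s_j^♯ = - s_0⁺ * ∑_{l=0}^{j-1} s_{j-l} * s_l^♯` for `j ≥ 1`. -/
noncomputable def reciprocal {p q : ℕ} (s : ℕ → Matrix (Fin p) (Fin q) ℂ) :
    ℕ → Matrix (Fin q) (Fin p) ℂ
  | 0 => mpInv (s 0)
  | j + 1 => -(mpInv (s 0) * ∑ l : Fin (j + 1), s (j + 1 - l) * reciprocal s l)
termination_by j => j
decreasing_by exact l.isLt

/-- The sequence `- α * s_{j-1} + s_j`, with `s_{-1} = 0`. -/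
def plusTransform {p q : ℕ} (α : ℂ) (s : ℕ → Matrix (Fin p) (Fin q) ℂ) :
    ℕ → Matrix (Fin p) (Fin q) ℂ
  | 0 => s 0
  | j + 1 => -(α • s j) + s (j + 1)

/-- The first `α`-Schur-Stieltjes transform: the `j`-th term is
`s_0 * (- u_{j+1}^♯) * s_0` where `u_j = - α * s_{j-1} + s_j`. -/
noncomputable def firstTransform {p q : ℕ} (α : ℂ) (s : ℕ → Matrix (Fin p) (Fin q) ℂ) :
    ℕ → Matrix (Fin p) (Fin q) ℂ :=
  fun j => s 0 * (-(reciprocal (plusTransform α s) (j + 1))) * s 0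

/-- The `k`-th `α`-Schur-Stieltjes transform: the `k`-fold iterate of the first one. If `s` has
length `κ`, then this sequence has length `κ - k`. -/
noncomputable def transform {p q : ℕ} (α : ℂ) :
    ℕ → (ℕ → Matrix (Fin p) (Fin q) ℂ) → (ℕ → Matrix (Fin p) (Fin q) ℂ)
  | 0, s => s
  | k + 1, s => firstTransform α (transform α k s)

end Transform

section Classes

/-- The block Hankel matrix `H_n = [s_{j+k}]_{j,k=0}^n`. -/
def hankel {q : ℕ} (n : ℕ) (s : ℕ → Matrix (Fin q) (Fin q) ℂ) :
    Matrix (Fin (n + 1) × Fin q) (Fin (n + 1) × Fin q) ℂ :=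
  Matrix.of fun a b => s ((a.1 : ℕ) + (b.1 : ℕ)) a.2 b.2

/-- The block column of `s_l, s_{l+1}, …, s_{l+n}`. -/
def blockCol {q : ℕ} (l n : ℕ) (s : ℕ → Matrix (Fin q) (Fin q) ℂ) :
    Matrix (Fin (n + 1) × Fin q) (Fin q) ℂ :=
  Matrix.of fun a b => s (l + (a.1 : ℕ)) a.2 b

/-- The block row of `s_l, s_{l+1}, …, s_{l+n}`. -/
def blockRow {q : ℕ} (l n : ℕ) (s : ℕ → Matrix (Fin q) (Fin q) ℂ) :
    Matrix (Fin q) (Fin (n + 1) × Fin q) ℂ :=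
  Matrix.of fun a b => s (l + (b.1 : ℕ)) a b.2

/-- `L_0 = s_0` and `L_n = s_{2n} - [s_n, …, s_{2n-1}] * H_{n-1}⁺ * col (s_n, …, s_{2n-1})` for
`n ≥ 1`. -/
noncomputable def schurL {q : ℕ} (s : ℕ → Matrix (Fin q) (Fin q) ℂ) :
    ℕ → Matrix (Fin q) (Fin q) ℂ
  | 0 => s 0
  | n + 1 => s (2 * (n + 1)) - blockRow (n + 1) n s * mpInv (hankel n s) * blockCol (n + 1) n s

/-- The right `α`-shifted sequence `a_j = - α * s_j + s_{j+1}`. -/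
def shift {q : ℕ} (α : ℂ) (s : ℕ → Matrix (Fin q) (Fin q) ℂ) :
    ℕ → Matrix (Fin q) (Fin q) ℂ :=
  fun j => -(α • s j) + s (j + 1)

/-- `s_0, …, s_{2n}` is Hankel non-negative definite: `H_n` is non-negative Hermitian. -/
def HankelNonneg {q : ℕ} (n : ℕ) (s : ℕ → Matrix (Fin q) (Fin q) ℂ) : Prop :=
  (hankel n s).PosSemidef

/-- `s_0, …, s_{2n}` is Hankel positive definite: `H_n` is positive Hermitian. -/
def HankelPos {q : ℕ} (n : ℕ) (s : ℕ → Matrix (Fin q) (Fin q) ℂ) : Prop :=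
  (hankel n s).PosDef

/-- `s_0, …, s_{2n}` is Hankel completely degenerate: it is Hankel non-negative definite and
`L_n = 0`. -/
def HankelCd {q : ℕ} (n : ℕ) (s : ℕ → Matrix (Fin q) (Fin q) ℂ) : Prop :=
  HankelNonneg n s ∧ schurL s n = 0

/-- The class `K^≥_{m,α}` for finite `m`. For `m = 2n` with `n ≥ 1` the two conditions are that the
matrices `H_n` of `s` and `H_{n-1}` of the shifted sequence are non-negative Hermitian, and for
`m = 2n+1` that `H_n` of `s` and `H_n` of the shifted sequence are. -/
def KNonnegFin {q : ℕ} (α : ℝ) : ℕ → (ℕ → Matrix (Fin q) (Fin q) ℂ) → Prop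
  | 0, s => HankelNonneg 0 s
  | m + 1, s => HankelNonneg ((m + 1) / 2) s ∧ HankelNonneg (m / 2) (shift (α : ℂ) s)

/-- The class `K^≥_{κ,α}`. -/
def KNonneg {q : ℕ} (α : ℝ) (κ : ℕ∞) (s : ℕ → Matrix (Fin q) (Fin q) ℂ) : Prop :=
  match κ with
  | ⊤ => ∀ m : ℕ, KNonnegFin α m s
  | (m : ℕ) => KNonnegFin α m s

/-- The class `K^{≥,e}_{κ,α}`: for finite `κ = m` there is a matrix `A` such that
`s_0, …, s_m, A` belongs to `K^≥_{m+1,α}`; for `κ = ∞` it is `K^≥_{∞,α}`. -/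
def KNonnegExt {q : ℕ} (α : ℝ) (κ : ℕ∞) (s : ℕ → Matrix (Fin q) (Fin q) ℂ) : Prop :=
  match κ with
  | ⊤ => KNonneg α ⊤ s
  | (m : ℕ) => ∃ A : Matrix (Fin q) (Fin q) ℂ, KNonnegFin α (m + 1) (Function.update s (m + 1) A)

/-- The class `K^>_{m,α}` for finite `m`. -/
def KPosFin {q : ℕ} (α : ℝ) : ℕ → (ℕ → Matrix (Fin q) (Fin q) ℂ) → Prop
  | 0, s => HankelPos 0 s
  | m + 1, s => HankelPos ((m + 1) / 2) s ∧ HankelPos (m / 2) (shift (α : ℂ) s)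

/-- The class `K^>_{κ,α}`. -/
def KPos {q : ℕ} (α : ℝ) (κ : ℕ∞) (s : ℕ → Matrix (Fin q) (Fin q) ℂ) : Prop :=
  match κ with
  | ⊤ => ∀ m : ℕ, KPosFin α m s
  | (m : ℕ) => KPosFin α m s

/-- The class `K^{≥,cd}_{m,α}` for finite `m`: for `m = 2n` the sequence `s_0, …, s_{2n}`, and for
`m = 2n+1` the shifted sequence `a_0, …, a_{2n}`, is Hankel completely degenerate. -/
def KCdFin {q : ℕ} (α : ℝ) (m : ℕ) (s : ℕ → Matrix (Fin q) (Fin q) ℂ) : Prop :=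
  KNonnegFin α m s ∧
    ((Even m → HankelCd (m / 2) s) ∧ (Odd m → HankelCd (m / 2) (shift (α : ℂ) s)))

/-- The class `K^{≥,cd}_{κ,α}`. -/
def KCd {q : ℕ} (α : ℝ) (κ : ℕ∞) (s : ℕ → Matrix (Fin q) (Fin q) ℂ) : Prop :=
  match κ with
  | ⊤ => KNonneg α ⊤ s ∧ ∃ m : ℕ, KCdFin α m s
  | (m : ℕ) => KCdFin α m s

/-- The class `K^{≥,cd,m}_{κ,α}` of those members of `K^≥_{κ,α}` whose initial section
`s_0, …, s_m` belongs to `K^{≥,cd}_{m,α}`. -/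
def KCdOrder {q : ℕ} (α : ℝ) (m : ℕ) (κ : ℕ∞) (s : ℕ → Matrix (Fin q) (Fin q) ℂ) : Prop :=
  KNonneg α κ s ∧ KCdFin α m s

end Classes

end SchurStieltjes

namespace SchurStieltjes

open Matrix
open scoped ComplexOrder

/-! ### Corner inverses of power series and the Toeplitz congruences of Hankel matrices. -/

section CornerInverse

open PowerSeries

variable {R : Type*} [Ring R]

/-! Encode sequences as power series over the ring of `q × q` matrices. With `s(z)` the generating
series, `u(z) = (1 - αz) s(z)`, and the reciprocal sequence gives an inverse `r(z)` of `u(z)` in the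
corner cut out by the projection `e = s₀ s₀⁺`. The identity `r(x) (u(x) - u(y))/(x - y) r(y) =
-(r(x) - r(y))/(x - y)`, multiplied by `s₀` on both sides, says that a lower triangular block
Toeplitz matrix `S` built from `s₀ r` satisfies `S H_n(a) S* = H_n(s^[1])` (`toeplitz_congruence`).
Since `(1 - αz) r(z)` is a corner inverse of `s(z)` itself, the same method turns `H_{n+1}(s)` into
a block diagonal matrix whose lower block is `H_n` of the shifted transform
(`toeplitz_congruence_succ`).

Thus one transform exchanges the two Hankel conditions and lowers the length by one. Congruence
preserves non-negativity. In the definite case `s₀` is invertible, so `e = 1`, `S` is invertible and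
positivity survives too. Complete degeneracy is rephrased as the existence of a kernel block column
with last block `1` (`schurL_eq_zero_iff`), and such a column is carried through the congruence even
if `S` is singular (`exists_kernel_of_congruence`). This needs `s_j e = s_j` below the last index
(`KNonnegFin.mul_projection`).

All terms can be taken Hermitian, as each class sees only an initial section. Iterating the one-step
results gives all five claims. -/

/-- `r` is a two-sided inverse of `e * u * e` in the corner ring of power series over `e * R * e`. -/
structure IsCornerInverse (e : R) (u r : R⟦X⟧) : Prop where
  left_unit : C e * r = r
  right_unit : r * C e = r
  mul_inv : C e * u * r = C e
  inv_mul : r * u * C e = C e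

/-- Lower triangular block Toeplitz matrix of a power series. -/
noncomputable def toeplitz (n : ℕ) (f : R⟦X⟧) : Matrix (Fin (n + 1)) (Fin (n + 1)) R :=
  Matrix.of fun i j => if j ≤ i then coeff ((i : ℕ) - j) f else 0

/-- The Hankel matrix `[h_{j+k}]_{j,k=0}^n` with entries in a ring. -/
def ringHankel (n : ℕ) (h : ℕ → R) : Matrix (Fin (n + 1)) (Fin (n + 1)) R :=
  Matrix.of fun i j => h ((i : ℕ) + j)

theorem sum_fin_le_eq_sum_range {A : Type*} [AddCommMonoid A] {n : ℕ} (i : Fin (n + 1))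
    (F : ℕ → A) :
    ∑ j : Fin (n + 1), (if j ≤ i then F j else 0) = ∑ j ∈ Finset.range (i + 1), F j := by
  have h := Fin.sum_univ_eq_sum_range (fun j => if j ≤ (i : ℕ) then F j else 0) (n + 1)
  simp only [Fin.le_def]
  rw [h, ← Finset.sum_filter]
  congr 1
  ext j
  simp only [Finset.mem_filter, Finset.mem_range]
  have := i.isLt
  omega

theorem toeplitz_mul (n : ℕ) (f g : R⟦X⟧) :
    toeplitz n (f * g) = toeplitz n f * toeplitz n g := by
  ext i j
  rw [Matrix.mul_apply]
  have h1 : ∀ k : Fin (n + 1), toeplitz n f i k * toeplitz n g k j =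
      if k ≤ i then (if (j : ℕ) ≤ k then coeff ((i : ℕ) - k) f * coeff ((k : ℕ) - j) g else 0)
        else 0 := by
    intro k
    simp only [toeplitz, Matrix.of_apply, Fin.le_def]
    split_ifs <;> simp
  rw [Finset.sum_congr rfl fun k _ => h1 k, sum_fin_le_eq_sum_range i (fun k =>
    if (j : ℕ) ≤ k then coeff ((i : ℕ) - k) f * coeff (k - (j : ℕ)) g else 0)]
  simp only [toeplitz, Matrix.of_apply, Fin.le_def]
  split_ifs with hji
  · rw [coeff_mul, ← Finset.sum_filter]
    refine Finset.sum_nbij' (fun p => p.2 + j) (fun k => (i - k, k - j)) ?_ ?_ ?_ ?_ ?_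
    · intro p hp
      simp only [Finset.HasAntidiagonal.mem_antidiagonal, Finset.mem_filter, Finset.mem_range] at *
      omega
    · intro p hp
      simp only [Finset.HasAntidiagonal.mem_antidiagonal, Finset.mem_filter, Finset.mem_range] at *
      omega
    · intro p hp
      simp only [Finset.HasAntidiagonal.mem_antidiagonal] at *
      ext <;> simp only <;> omega
    · intro p hp
      simp only [Finset.mem_filter, Finset.mem_range] at *
      omega
    · intro p hp
      simp only [Finset.HasAntidiagonal.mem_antidiagonal] at hp
      congr 3 <;> omega
  · symm
    apply Finset.sum_eq_zero
    intro k hk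
    rw [if_neg]
    simp only [Finset.mem_range] at hk
    omega

theorem toeplitz_C (n : ℕ) (a : R) : toeplitz n (C a) = Matrix.diagonal fun _ => a := by
  ext i j
  simp only [toeplitz, Matrix.of_apply, coeff_C, Matrix.diagonal_apply, Fin.le_def, Fin.ext_iff]
  split_ifs <;> first | rfl | omega

theorem toeplitz_mul_ringHankel_mul [StarRing R] (n : ℕ) (f : R⟦X⟧) (h : ℕ → R)
    (i k : Fin (n + 1)) :
    (toeplitz n f * ringHankel n h * (toeplitz n f)ᴴ) i k =
      ∑ a ∈ Finset.range (i + 1), ∑ b ∈ Finset.range (k + 1),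
        coeff ((i : ℕ) - a) f * h (a + b) * star (coeff ((k : ℕ) - b) f) := by
  rw [Matrix.mul_assoc, Matrix.mul_apply]
  have h1 : ∀ a : Fin (n + 1), (ringHankel n h * (toeplitz n f)ᴴ) a k =
      ∑ b ∈ Finset.range (k + 1), h (a + b) * star (coeff ((k : ℕ) - b) f) := by
    intro a
    rw [← sum_fin_le_eq_sum_range k fun b => h (a + b) * star (coeff ((k : ℕ) - b) f),
      Matrix.mul_apply]
    refine Finset.sum_congr rfl fun b _ => ?_
    simp only [ringHankel, toeplitz, Matrix.of_apply, Matrix.conjTranspose_apply]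
    split_ifs <;> simp
  rw [← sum_fin_le_eq_sum_range i fun a => ∑ b ∈ Finset.range (k + 1),
        coeff ((i : ℕ) - a) f * h (a + b) * star (coeff ((k : ℕ) - b) f)]
  refine Finset.sum_congr rfl fun a _ => ?_
  rw [h1]
  simp only [toeplitz, Matrix.of_apply]
  split_ifs
  · simp only [Finset.mul_sum, mul_assoc]
  · simp

namespace IsCornerInverse

variable {e : R} {u r : R⟦X⟧}

theorem coeff_mul_mul_coeff (h : IsCornerInverse e u r) (j k : ℕ) :
    coeff j (r * u) * coeff k r = if j = 0 then coeff k r else 0 := by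
  have h1 : coeff k r = e * coeff k r := by rw [← coeff_C_mul, h.left_unit]
  have h2 : coeff j (r * u) * e = if j = 0 then e else 0 := by
    rw [← coeff_mul_C, h.inv_mul, coeff_C]
  rw [h1, ← mul_assoc, h2]
  split_ifs <;> simp

theorem coeff_mul_coeff_mul (h : IsCornerInverse e u r) (j k : ℕ) :
    coeff j r * coeff k (u * r) = if k = 0 then coeff j r else 0 := by
  have h1 : coeff j r = coeff j r * e := by rw [← coeff_mul_C, h.right_unit]
  have h2 : e * coeff k (u * r) = if k = 0 then e else 0 := by
    rw [← coeff_C_mul, ← mul_assoc, h.mul_inv, coeff_C]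
  rw [h1, mul_assoc, h2]
  split_ifs <;> simp

theorem coeff_mul_eq_sum_range_sub (f g : R⟦X⟧) (j : ℕ) :
    coeff j (f * g) = ∑ i ∈ Finset.range (j + 1), coeff (j - i) f * coeff i g := by
  rw [coeff_mul, ← Finset.Nat.sum_antidiagonal_swap]
  exact Finset.Nat.sum_antidiagonal_eq_sum_range_succ (fun a b => coeff b f * coeff a g) j

theorem coeff_mul_eq_sum_range_sub' (f g : R⟦X⟧) (j : ℕ) :
    coeff j (f * g) = ∑ i ∈ Finset.range (j + 1), coeff i f * coeff (j - i) g := by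
  rw [coeff_mul]
  exact Finset.Nat.sum_antidiagonal_eq_sum_range_succ (fun a b => coeff a f * coeff b g) j

theorem sum_succ_mul_coeff (h : IsCornerInverse e u r) (j k : ℕ) :
    (∑ i ∈ Finset.range (j + 1), coeff (j - i) r * coeff (i + 1) u) * coeff k r =
      -(coeff (j + 1) r * coeff 0 u * coeff k r) := by
  have h1 := h.coeff_mul_mul_coeff (j + 1) k
  rw [coeff_mul_eq_sum_range_sub, Finset.sum_range_succ', if_neg (Nat.succ_ne_zero j), add_mul,
    Nat.sub_zero] at h1
  simp only [Nat.add_sub_add_right] at h1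
  exact eq_neg_of_add_eq_zero_left h1

theorem coeff_mul_sum_succ (h : IsCornerInverse e u r) (j k : ℕ) :
    coeff j r * (∑ l ∈ Finset.range (k + 1), coeff (l + 1) u * coeff (k - l) r) =
      -(coeff j r * coeff 0 u * coeff (k + 1) r) := by
  have h1 := h.coeff_mul_coeff_mul j (k + 1)
  rw [coeff_mul_eq_sum_range_sub', Finset.sum_range_succ', if_neg (Nat.succ_ne_zero k), mul_add,
    Nat.sub_zero, ← mul_assoc] at h1
  simp only [Nat.add_sub_add_right] at h1
  exact eq_neg_of_add_eq_zero_left h1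

/-- Coefficient form of `r(x) * ((u(x) - u(y)) / (x - y)) * r(y) = -(r(x) - r(y)) / (x - y)`. -/
theorem sum_coeff_succ (h : IsCornerInverse e u r) (j k : ℕ) :
    ∑ i ∈ Finset.range (j + 1), ∑ l ∈ Finset.range (k + 1),
      coeff (j - i) r * coeff (i + l + 1) u * coeff (k - l) r = -coeff (j + k + 1) r := by
  induction j generalizing k with
  | zero =>
    rw [Finset.sum_range_one]
    simp only [Nat.sub_zero, zero_add, mul_assoc]
    rw [← Finset.mul_sum, h.coeff_mul_sum_succ]
    have := h.coeff_mul_mul_coeff 0 (k + 1)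
    rw [coeff_mul_eq_sum_range_sub, Finset.sum_range_one, if_pos rfl] at this
    rw [this]
  | succ j ih =>
    -- Pass from `(j, k + 1)` to `(j + 1, k)`, which leaves the right side unchanged. The double
    -- sums share their interior; the boundary terms `l = 0` and `i = 0` both equal `-r_{j+1} u₀
    -- r_{k+1}`.
    have key := ih (k + 1)
    rw [show j + 1 + k + 1 = j + (k + 1) + 1 by ring, ← key, Finset.sum_range_succ']
    have h1 := h.sum_succ_mul_coeff j (k + 1)
    have h2 := h.coeff_mul_sum_succ (j + 1) k
    have h3 : ∀ i, ∑ l ∈ Finset.range (k + 1 + 1),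
          coeff (j - i) r * coeff (i + l + 1) u * coeff (k + 1 - l) r =
        ∑ l ∈ Finset.range (k + 1),
          coeff (j - i) r * coeff (i + 1 + l + 1) u * coeff (k - l) r +
        coeff (j - i) r * coeff (i + 1) u * coeff (k + 1) r := by
      intro i
      rw [Finset.sum_range_succ']
      simp only [Nat.add_sub_add_right, Nat.sub_zero, add_zero]
      congr 1
      refine Finset.sum_congr rfl fun l _ => ?_
      rw [show i + (l + 1) + 1 = i + 1 + l + 1 by ring]
    simp only [h3, Finset.sum_add_distrib, Nat.add_sub_add_right, Nat.sub_zero, zero_add]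
    congr 1
    rw [← Finset.sum_mul, h1, ← h2, Finset.mul_sum]
    simp only [mul_assoc]

theorem sum_coeff_zero_right (h : IsCornerInverse e u r) (j : ℕ) :
    ∑ i ∈ Finset.range (j + 1), coeff (j - i) r * coeff i u * coeff 0 r =
      if j = 0 then coeff 0 r else 0 := by
  rw [← Finset.sum_mul, ← coeff_mul_eq_sum_range_sub, h.coeff_mul_mul_coeff]

/-- The unshifted Hankel kernel is `u(x) + y (u(x) - u(y))/(x - y)`. Between `r(x)` and `r(y)` the
first term contributes only in row `j = 0`, by the inverse property; the second is `sum_coeff_succ`.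
-/
theorem sum_coeff_succ_right (h : IsCornerInverse e u r) (j k : ℕ) :
    ∑ i ∈ Finset.range (j + 1), ∑ l ∈ Finset.range (k + 1 + 1),
      coeff (j - i) r * coeff (i + l) u * coeff (k + 1 - l) r =
      (if j = 0 then coeff (k + 1) r else 0) - coeff (j + k + 1) r := by
  have h3 : ∀ i, ∑ l ∈ Finset.range (k + 1 + 1),
          coeff (j - i) r * coeff (i + l) u * coeff (k + 1 - l) r =
        ∑ l ∈ Finset.range (k + 1),
          coeff (j - i) r * coeff (i + l + 1) u * coeff (k - l) r +
        coeff (j - i) r * coeff i u * coeff (k + 1) r := by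
    intro i
    rw [Finset.sum_range_succ']
    simp only [Nat.add_sub_add_right, Nat.sub_zero, add_zero]
    rfl
  simp only [h3, Finset.sum_add_distrib]
  rw [h.sum_coeff_succ, ← Finset.sum_mul, ← coeff_mul_eq_sum_range_sub, h.coeff_mul_mul_coeff]
  abel

variable [StarRing R] {c : R}

theorem toeplitz_congruence (h : IsCornerInverse e u r) (hc : star c = c)
    (hr : ∀ j, star (coeff j r) = coeff j r) (n : ℕ) :
    toeplitz n (C c * r) * ringHankel n (fun j => coeff (j + 1) u) * (toeplitz n (C c * r))ᴴ =
      ringHankel n fun j => c * -coeff (j + 1) r * c := by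
  ext i k
  rw [toeplitz_mul_ringHankel_mul]
  simp only [coeff_C_mul, star_mul, hr, hc, ringHankel, Matrix.of_apply]
  rw [← h.sum_coeff_succ]
  simp only [Finset.mul_sum, Finset.sum_mul, mul_assoc]

/-- Off row and column zero the congruent matrix is a Hankel matrix in the `r_{j+2}`, and the first
column vanishes below its top entry, so the first block splits off. -/
theorem toeplitz_congruence_succ (h : IsCornerInverse e u r) (hc : star c = c)
    (hr : ∀ j, star (coeff j r) = coeff j r) (n : ℕ) (i : Fin (n + 1)) :
    (∀ k : Fin (n + 1), (toeplitz (n + 1) (C c * r) * ringHankel (n + 1) (fun j => coeff j u) *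
      (toeplitz (n + 1) (C c * r))ᴴ) i.succ k.succ = c * -coeff ((i : ℕ) + k + 2) r * c) ∧
    (toeplitz (n + 1) (C c * r) * ringHankel (n + 1) (fun j => coeff j u) *
      (toeplitz (n + 1) (C c * r))ᴴ) i.succ 0 = 0 := by
  refine ⟨fun k => ?_, ?_⟩
  · rw [toeplitz_mul_ringHankel_mul]
    simp only [coeff_C_mul, star_mul, hr, hc, Fin.val_succ]
    have := h.sum_coeff_succ_right (i + 1) k
    rw [if_neg (Nat.succ_ne_zero _), zero_sub,
      show (i : ℕ) + 1 + k + 1 = i + k + 2 by ring] at this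
    rw [← this]
    simp only [Finset.mul_sum, Finset.sum_mul, mul_assoc]
  · rw [toeplitz_mul_ringHankel_mul]
    simp only [coeff_C_mul, star_mul, hr, hc, Fin.val_succ, Fin.val_zero, zero_add,
      Finset.sum_range_one, Nat.sub_zero, add_zero]
    have := h.sum_coeff_zero_right (i + 1)
    rw [if_neg (Nat.succ_ne_zero _)] at this
    have h2 := congrArg (fun x => c * x * c) this
    simp only [Finset.mul_sum, Finset.sum_mul, mul_zero, zero_mul] at h2
    rw [← h2]
    simp only [mul_assoc]

variable {d : R}

omit [StarRing R] in
theorem mul_toeplitz_factor (h : IsCornerInverse e u r) (hdc : d * c = e) :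
    (C e * u * C d) * (C c * r) = C e := by
  rw [mul_assoc, ← mul_assoc (C d), ← map_mul, hdc, h.left_unit, h.mul_inv]

/-- A kernel block column with last block `1` of a Hankel matrix gives rise to such a block column
of the congruent matrix. -/
theorem exists_kernel_of_congruence (h : IsCornerInverse e u r) (he : star e = e)
    (hdc : d * c = e) (hcd : c * d = e) (hec : e * c = c) (hu : coeff 0 u = c) {n : ℕ}
    {a : ℕ → R} (ha : ∀ j < 2 * n, a j * e = a j) (hah : ∀ j ≤ 2 * n, star (a j) = a j)
    {Y : Fin (n + 1) → R} (hY : ringHankel n a *ᵥ Y = 0) (hY1 : Y (Fin.last n) = 1) :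
    ∃ Z : Fin (n + 1) → R, (toeplitz n (C c * r) * ringHankel n a * (toeplitz n (C c * r))ᴴ) *ᵥ Z
      = 0 ∧ Z (Fin.last n) = 1 := by
  -- The range condition is not assumed for the last coefficient; the last row of the kernel
  -- equation writes it through the earlier ones, so `1 - e` annihilates it as well.
  have hlast : a (2 * n) * e = a (2 * n) := by
    have h1 := congrFun hY (Fin.last n)
    simp only [Matrix.mulVec, dotProduct, ringHankel, Matrix.of_apply, Pi.zero_apply] at h1
    have h2 := congrArg (fun x => (1 - e) * x) h1
    simp only [Finset.mul_sum, mul_zero] at h2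
    rw [Finset.sum_eq_single (Fin.last n)] at h2
    · rw [hY1, mul_one, Fin.val_last, ← two_mul] at h2
      have h3 := congrArg star h2
      rw [star_mul, hah _ le_rfl, star_sub, star_one, he, star_zero, mul_sub, mul_one,
        sub_eq_zero] at h3
      exact h3.symm
    · intro b _ hb
      have hb' : (b : ℕ) < n := Fin.val_lt_last hb
      rw [Fin.val_last, ← mul_assoc]
      have h3 := congrArg star (ha (n + b) (by omega))
      rw [star_mul, hah _ (by omega), he] at h3
      rw [sub_mul, one_mul, h3, sub_self, zero_mul]
    · simp
  have hHe : ringHankel n a * Matrix.diagonal (fun _ => e) = ringHankel n a := by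
    ext i j
    rw [Matrix.mul_diagonal]
    simp only [ringHankel, Matrix.of_apply]
    have := i.isLt
    have := j.isLt
    rcases Nat.lt_or_ge ((i : ℕ) + j) (2 * n) with h1 | h1
    · exact ha _ h1
    · rw [show (i : ℕ) + j = 2 * n by omega]; exact hlast
  set S := toeplitz n (C c * r) with hS
  set G := toeplitz n (C e * u * C d) with hG
  have hSG : Sᴴ * Gᴴ = Matrix.diagonal (fun _ => e) := by
    rw [← conjTranspose_mul, ← toeplitz_mul, h.mul_toeplitz_factor hdc, toeplitz_C,
      Matrix.diagonal_conjTranspose]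
    congr 1
    ext
    simp [he]
  have hSe : Sᴴ *ᵥ Pi.single (Fin.last n) (1 - e) = 0 := by
    ext i
    simp only [Matrix.mulVec_single, Matrix.col_apply, Pi.smul_apply, Matrix.conjTranspose_apply, hS,
      toeplitz, Matrix.of_apply, Fin.le_last, if_true, coeff_C_mul, MulOpposite.smul_eq_mul_unop,
      MulOpposite.unop_op, Pi.zero_apply]
    have h4 : (1 - e) * (c * coeff ((Fin.last n : ℕ) - i) r) = 0 := by
      rw [← mul_assoc, sub_mul, hec, one_mul, sub_self, zero_mul]
    have h5 := congrArg star h4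
    rwa [star_mul, star_sub, star_one, he, star_zero] at h5
  -- `Gᴴ` inverts `Sᴴ` only up to `e`, so the last block of `Gᴴ Y` is `e`. The correction `1 - e`
  -- restores it to `1` at no cost, since `Sᴴ` kills it.
  refine ⟨Gᴴ *ᵥ Y + Pi.single (Fin.last n) (1 - e), ?_, ?_⟩
  · rw [Matrix.mulVec_add, Matrix.mulVec_mulVec, Matrix.mul_assoc, Matrix.mul_assoc,
      Matrix.mul_assoc, hSG, hHe, ← Matrix.mul_assoc, ← Matrix.mulVec_mulVec, hY,
      Matrix.mulVec_zero, ← Matrix.mulVec_mulVec, hSe, Matrix.mulVec_zero, add_zero]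
  · rw [Pi.add_apply, Pi.single_eq_same]
    have hG0 : e * c * d = e := by rw [hec, hcd]
    have : (Gᴴ *ᵥ Y) (Fin.last n) = e := by
      rw [Matrix.mulVec, dotProduct, Finset.sum_eq_single (Fin.last n)]
      · simp [hY1, hG, toeplitz, Matrix.conjTranspose_apply, coeff_mul_C, coeff_C_mul, hu, hG0, he]
      · intro b _ hb
        have hb' : (b : ℕ) < n := Fin.val_lt_last hb
        rw [Matrix.conjTranspose_apply, hG, toeplitz, Matrix.of_apply, if_neg, star_zero, zero_mul]
        exact not_le.2 hb'
      · simp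
    rw [this]
    abel

end IsCornerInverse

end CornerInverse

/-! ### Non-negative block Hankel matrices and vanishing Schur complements. -/

section BlockMatrices

variable {q : ℕ}

theorem compRingEquiv_ringHankel (n : ℕ) (s : ℕ → Matrix (Fin q) (Fin q) ℂ) :
    compRingEquiv (Fin (n + 1)) (Fin q) ℂ (ringHankel n s) = hankel n s := rfl

theorem compRingEquiv_conjTranspose {m : Type*} [Fintype m]
    (M : Matrix m m (Matrix (Fin q) (Fin q) ℂ)) :
    compRingEquiv m (Fin q) ℂ Mᴴ = (compRingEquiv m (Fin q) ℂ M)ᴴ := rfl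

theorem _root_.Matrix.PosSemidef.mul_eq_zero_of_conjTranspose_mul_mul {m n : Type*} [Fintype m]
    {M : Matrix m m ℂ} (hM : M.PosSemidef) {Y : Matrix m n ℂ} (h : Yᴴ * (M * Y) = 0) :
    M * Y = 0 := by
  ext i j
  have h1 : star (Y.col j) ⬝ᵥ (M *ᵥ Y.col j) = 0 := by
    have := congrFun (congrFun h j) j
    simpa [Matrix.mul_apply, dotProduct, Matrix.mulVec, Matrix.col] using this
  have h2 := congrFun ((hM.dotProduct_mulVec_zero_iff _).1 h1) i
  simpa [Matrix.mul_apply, dotProduct, Matrix.mulVec, Matrix.col] using h2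

/-- The column with blocks `Y` and `0` is isotropic for the whole block matrix, hence lies in its
kernel; its image has lower block `Bᴴ * Y`. -/
theorem _root_.Matrix.PosSemidef.conjTranspose_mul_eq_zero_of_fromBlocks {m n l : Type*} [Fintype m]
    [Fintype n] {A : Matrix m m ℂ} {B : Matrix m n ℂ} {D : Matrix n n ℂ}
    (hM : (fromBlocks A B Bᴴ D).PosSemidef) {Y : Matrix m l ℂ} (h : A * Y = 0) : Bᴴ * Y = 0 := by
  have h1 : fromBlocks A B Bᴴ D * fromRows Y (0 : Matrix n l ℂ) = fromRows 0 (Bᴴ * Y) := by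
    rw [fromBlocks_mul_fromRows, h]
    simp
  have h2 := hM.mul_eq_zero_of_conjTranspose_mul_mul (Y := fromRows Y (0 : Matrix n l ℂ)) (by
    rw [h1, conjTranspose_fromRows_eq_fromCols_conjTranspose, fromCols_mul_fromRows]
    simp)
  rw [h1, ← fromRows_zero, fromRows_ext_iff] at h2
  exact h2.2

/-- The generalized Schur complement of a non-negative block matrix vanishes iff the block matrix
has a kernel block column with last block `1`. -/
theorem schurComplement_eq_zero_iff {m n : Type*} [Fintype m] [Fintype n] [DecidableEq n]
    {A : Matrix m m ℂ} {B : Matrix m n ℂ} {D : Matrix n n ℂ}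
    (hM : (fromBlocks A B Bᴴ D).PosSemidef) :
    D - Bᴴ * mpInv A * B = 0 ↔ ∃ W : Matrix m n ℂ, A * W + B = 0 ∧ Bᴴ * W + D = 0 := by
  classical
  have hA : Aᴴ = A := (isHermitian_fromBlocks_iff.1 hM.isHermitian).1
  have hX := mpInv_spec A
  -- Non-negativity forces the kernel of `A` into that of `Bᴴ`; this and `h2` make the Moore-Penrose
  -- inverse act as a true inverse on `B`.
  have h1 : Bᴴ * (mpInv A * A) = Bᴴ := by
    have := hM.conjTranspose_mul_eq_zero_of_fromBlocks (Y := 1 - mpInv A * A) (by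
      rw [Matrix.mul_sub, ← Matrix.mul_assoc, hX.mul_mul_left, Matrix.mul_one, sub_self])
    rw [Matrix.mul_sub, Matrix.mul_one, sub_eq_zero] at this
    exact this.symm
  have h2 : A * mpInv A * B = B := by
    have := hM.conjTranspose_mul_eq_zero_of_fromBlocks (Y := 1 - A * mpInv A) (by
      have := congrArg conjTranspose hX.mul_mul_left
      rw [conjTranspose_mul, hX.isHermitian_left.eq, hA] at this
      rw [Matrix.mul_sub, Matrix.mul_one, this, sub_self])
    have := congrArg conjTranspose this
    rw [conjTranspose_mul, conjTranspose_sub, hX.isHermitian_left.eq, conjTranspose_one,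
      conjTranspose_conjTranspose, conjTranspose_zero, Matrix.sub_mul, Matrix.one_mul,
      sub_eq_zero] at this
    exact this.symm
  constructor
  · intro h
    refine ⟨-(mpInv A * B), ?_, ?_⟩
    · rw [Matrix.mul_neg, ← Matrix.mul_assoc, h2, neg_add_cancel]
    · rw [Matrix.mul_neg, ← Matrix.mul_assoc, neg_add_eq_sub, h]
  · rintro ⟨W, hW1, hW2⟩
    have h3 : Bᴴ * mpInv A * B = -(Bᴴ * W) := by
      refine (congrArg (Bᴴ * mpInv A * ·) (eq_neg_of_add_eq_zero_right hW1)).trans ?_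
      rw [Matrix.mul_neg, ← Matrix.mul_assoc, Matrix.mul_assoc Bᴴ, h1]
    rw [h3, sub_neg_eq_add, add_comm, hW2]

/-- The embedding of the index set of a bordered Hankel matrix. -/
def borderIndex (n q : ℕ) : (Fin (n + 1) × Fin q) ⊕ Fin q → Fin (n + 1 + 1) × Fin q :=
  Sum.elim (fun a => (a.1.castSucc, a.2)) (fun b => (Fin.last _, b))

variable {s : ℕ → Matrix (Fin q) (Fin q) ℂ}

theorem HankelNonneg.mono {m n : ℕ} (hmn : m ≤ n) (h : HankelNonneg n s) : HankelNonneg m s :=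
  PosSemidef.submatrix h
    (fun a : Fin (m + 1) × Fin q => (Fin.castLE (Nat.succ_le_succ hmn) a.1, a.2))

theorem HankelNonneg.conjTranspose_eq {n j : ℕ} (h : HankelNonneg n s) (hj : j ≤ 2 * n) :
    (s j)ᴴ = s j := by
  obtain ⟨a, b, ha, hb, rfl⟩ : ∃ a b, a ≤ n ∧ b ≤ n ∧ a + b = j :=
    ⟨min j n, j - min j n, by omega, by omega, by omega⟩
  ext i k
  have := congrFun (congrFun h.isHermitian.eq
    ((⟨a, by omega⟩ : Fin (n + 1)), i)) ((⟨b, by omega⟩ : Fin (n + 1)), k)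
  rw [Matrix.conjTranspose_apply] at this
  simp only [hankel, Matrix.of_apply] at this
  rw [Matrix.conjTranspose_apply, ← this, add_comm]

/-- The block column with `Q` in position `i` and zeros elsewhere is isotropic, because `s_{2i} Q =
0`. The Hankel matrix therefore kills it, and block `l` of the image is `s_{i+l} Q`. -/
theorem HankelNonneg.mul_eq_zero {n i l : ℕ} (h : HankelNonneg n s) (hi : i ≤ n) (hl : l ≤ n)
    {Q : Matrix (Fin q) (Fin q) ℂ} (hQ : s (2 * i) * Q = 0) : s (i + l) * Q = 0 := by
  let Y : Matrix (Fin (n + 1) × Fin q) (Fin q) ℂ :=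
    Matrix.of fun a b => if a.1 = (⟨i, by omega⟩ : Fin (n + 1)) then Q a.2 b else 0
  have hY : ∀ a b, (hankel n s * Y) a b = (s (a.1 + i) * Q) a.2 b := by
    intro a b
    rw [Matrix.mul_apply, Fintype.sum_prod_type, Matrix.mul_apply,
      Finset.sum_eq_single (⟨i, by omega⟩ : Fin (n + 1))]
    · simp [hankel, Y]
    · intro c _ hc
      simp [Y, hc]
    · simp
  have h1 := PosSemidef.mul_eq_zero_of_conjTranspose_mul_mul h (Y := Y) (by
    ext a b
    rw [Matrix.mul_apply, Fintype.sum_prod_type,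
      Finset.sum_eq_single (⟨i, by omega⟩ : Fin (n + 1))]
    · simp only [hY, ← two_mul, hQ]
      simp
    · intro c _ hc
      simp [Y, hc, Matrix.conjTranspose_apply]
    · simp)
  ext a b
  have h2 := hY ((⟨l, by omega⟩ : Fin (n + 1)), a) b
  rw [h1] at h2
  rw [add_comm, ← h2]
  rfl

theorem hankel_submatrix_borderIndex {n : ℕ} (h : HankelNonneg (n + 1) s) :
    (hankel (n + 1) s).submatrix (borderIndex n q) (borderIndex n q) =
      fromBlocks (hankel n s) (blockCol (n + 1) n s) (blockCol (n + 1) n s)ᴴ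
        (s (2 * (n + 1))) := by
  ext (a | a) (b | b)
  · simp [hankel, borderIndex]
  · simp [hankel, borderIndex, blockCol, add_comm]
  · simp only [borderIndex, blockCol, submatrix_apply, Sum.elim_inl, Sum.elim_inr,
      fromBlocks_apply₂₁, hankel, Matrix.of_apply, Matrix.conjTranspose_apply]
    have := b.1.isLt
    rw [← h.conjTranspose_eq (j := n + 1 + b.1) (by omega), Matrix.conjTranspose_apply, star_star]
    simp
  · simp [hankel, borderIndex, two_mul]

theorem blockRow_eq_conjTranspose {n : ℕ} (h : HankelNonneg (n + 1) s) :
    blockRow (n + 1) n s = (blockCol (n + 1) n s)ᴴ := by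
  ext a b
  have := b.1.isLt
  have h3 := h.conjTranspose_eq (j := n + 1 + b.1) (by omega)
  simpa [blockRow, blockCol] using (congrFun (congrFun h3 a) b.2).symm

theorem schurL_eq_zero_iff {n : ℕ} (h : HankelNonneg n s) :
    schurL s n = 0 ↔ ∃ Y : Fin (n + 1) → Matrix (Fin q) (Fin q) ℂ,
      ringHankel n s *ᵥ Y = 0 ∧ Y (Fin.last n) = 1 := by
  cases n with
  | zero =>
    constructor
    · intro h0
      refine ⟨fun _ => 1, ?_, rfl⟩
      ext1 i
      have h0 : s 0 = 0 := h0
      simp [Matrix.mulVec, dotProduct, ringHankel, Fin.fin_one_eq_zero, h0]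
    · rintro ⟨Y, h0, h1⟩
      have := congrFun h0 0
      simp only [Matrix.mulVec, dotProduct, ringHankel, Matrix.of_apply] at this
      rw [Fin.sum_univ_one, show (0 : Fin (0 + 1)) = Fin.last 0 from rfl, h1, mul_one] at this
      exact this
  | succ n =>
    have hps := PosSemidef.submatrix h (borderIndex n q)
    rw [hankel_submatrix_borderIndex h] at hps
    rw [schurL, blockRow_eq_conjTranspose h, schurComplement_eq_zero_iff hps]
    have e1 : ∀ (Y : Fin (n + 1 + 1) → Matrix (Fin q) (Fin q) ℂ) (W : Matrix (Fin (n + 1) × Fin q)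
        (Fin q) ℂ), Y (Fin.last _) = 1 → (∀ a b, W a b = Y a.1.castSucc a.2 b) →
        (ringHankel (n + 1) s *ᵥ Y = 0 ↔ hankel n s * W + blockCol (n + 1) n s = 0 ∧
          (blockCol (n + 1) n s)ᴴ * W + s (2 * (n + 1)) = 0) := by
      intro Y W hY hW
      rw [← blockRow_eq_conjTranspose h]
      have f1 : ∀ i : Fin (n + 1 + 1), (ringHankel (n + 1) s *ᵥ Y) i =
          ∑ k : Fin (n + 1), s (i + k) * Y k.castSucc + s (i + (n + 1)) := by
        intro i
        simp only [Matrix.mulVec, dotProduct, ringHankel, Matrix.of_apply]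
        rw [Fin.sum_univ_castSucc, hY, mul_one]
        rfl
      have f2 : ∀ a b, (hankel n s * W + blockCol (n + 1) n s) a b =
          (ringHankel (n + 1) s *ᵥ Y) a.1.castSucc a.2 b := by
        intro a b
        rw [f1, Matrix.add_apply, Matrix.add_apply, Matrix.mul_apply, Fintype.sum_prod_type,
          Matrix.sum_apply]
        simp [Matrix.mul_apply, hankel, blockCol, hW, add_comm]
      have f3 : ∀ a b, (blockRow (n + 1) n s * W + s (2 * (n + 1))) a b =
          (ringHankel (n + 1) s *ᵥ Y) (Fin.last _) a b := by
        intro a b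
        rw [f1, Matrix.add_apply, Matrix.add_apply, Matrix.mul_apply, Fintype.sum_prod_type,
          Matrix.sum_apply]
        simp [Matrix.mul_apply, blockRow, hW, two_mul]
      constructor
      · intro h0
        rw [h0] at f2 f3
        exact ⟨by ext a b; rw [f2]; rfl, by ext a b; rw [f3]; rfl⟩
      · rintro ⟨g1, g2⟩
        ext i a b
        induction i using Fin.lastCases with
        | last => rw [← f3, g2]; rfl
        | cast i => rw [← f2 (i, a), g1]; rfl
    constructor
    · rintro ⟨W, hW⟩
      refine ⟨Fin.snoc (fun i => Matrix.of fun a b => W (i, a) b) 1, ?_, by simp⟩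
      exact (e1 _ W (by simp) (by simp)).2 hW
    · rintro ⟨Y, h0, h1⟩
      exact ⟨Matrix.of fun a b => Y a.1.castSucc a.2 b, (e1 Y _ h1 fun _ _ => rfl).1 h0⟩

end BlockMatrices

/-! ### The reciprocal sequence as a corner inverse. -/

section Reciprocal

open PowerSeries

/-- The power series with the adjoint coefficients. -/
noncomputable def starSeries {R : Type*} [Ring R] [StarRing R] (f : R⟦X⟧) : R⟦X⟧ :=
  PowerSeries.mk fun j => star (coeff j f)

theorem starSeries_mul {R : Type*} [Ring R] [StarRing R] (f g : R⟦X⟧) :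
    starSeries (f * g) = starSeries g * starSeries f := by
  ext j
  simp only [starSeries, coeff_mk, coeff_mul, star_sum, star_mul]
  rw [← Finset.Nat.sum_antidiagonal_swap]
  rfl

theorem starSeries_C {R : Type*} [Ring R] [StarRing R] (a : R) :
    starSeries (C a) = C (star a) := by
  ext j
  simp only [starSeries, coeff_mk, coeff_C]
  split_ifs <;> simp

/-- The adjoint of a right inverse of a self-adjoint series is a left inverse, and the two coincide
by the usual associativity argument. -/
theorem starSeries_eq_of_corner {R : Type*} [Ring R] [StarRing R] {e : R} {u r : R⟦X⟧}
    (he : star e = e) (hu : starSeries u = u) (h1 : C e * r = r)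
    (h3 : C e * u * r = C e) : starSeries r = r := by
  have h2' := congrArg starSeries h1
  have h3' := congrArg starSeries h3
  simp only [starSeries_mul, starSeries_C, he, hu] at h2' h3'
  calc starSeries r = starSeries r * C e := h2'.symm
    _ = starSeries r * (C e * u * r) := by rw [h3]
    _ = starSeries r * C e * u * (C e * r) := by rw [h1]; simp only [mul_assoc]
    _ = starSeries r * (u * C e) * r := by rw [h2']; simp only [mul_assoc]
    _ = r := by rw [h3', h1]

theorem IsCornerInverse.of_star {R : Type*} [Ring R] [StarRing R] {e : R} {u r : R⟦X⟧}
    (he : star e = e) (hu : starSeries u = u) (h1 : C e * r = r) (h2 : r * C e = r)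
    (h3 : C e * u * r = C e) : IsCornerInverse e u r := by
  refine ⟨h1, h2, h3, ?_⟩
  have h3' := congrArg starSeries h3
  simp only [starSeries_mul, starSeries_C, he, hu,
    starSeries_eq_of_corner he hu h1 h3] at h3'
  rw [mul_assoc, h3']

variable {q : ℕ} {s u : ℕ → Matrix (Fin q) (Fin q) ℂ}

theorem mpInv_isHermitian {A : Matrix (Fin q) (Fin q) ℂ} (hA : Aᴴ = A) : (mpInv A)ᴴ = mpInv A := by
  have h := mpInv_spec A
  refine IsMoorePenrose.unique (A := A) ⟨?_, ?_, ?_, ?_⟩ h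
  · have := congrArg conjTranspose h.mul_mul_left
    simpa only [conjTranspose_mul, hA, Matrix.mul_assoc] using this
  · have := congrArg conjTranspose h.mul_mul_right
    simpa only [conjTranspose_mul, hA, Matrix.mul_assoc] using this
  · have := h.isHermitian_right
    rw [← this.eq, conjTranspose_mul, hA] at this
    exact this
  · have := h.isHermitian_left
    rw [← this.eq, conjTranspose_mul, hA] at this
    exact this

theorem mpInv_mul_self_of_isHermitian {A : Matrix (Fin q) (Fin q) ℂ} (hA : Aᴴ = A) :
    mpInv A * A = A * mpInv A := by
  have h := (mpInv_spec A).isHermitian_left.eq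
  rwa [conjTranspose_mul, hA, mpInv_isHermitian hA] at h

theorem reciprocal_succ (j : ℕ) :
    reciprocal s (j + 1) = -(mpInv (s 0) * ∑ l ∈ Finset.range (j + 1),
      s (j + 1 - l) * reciprocal s l) := by
  rw [reciprocal, Fin.sum_univ_eq_sum_range (fun l => s (j + 1 - l) * reciprocal s l)]

theorem reciprocal_zero : reciprocal s 0 = mpInv (s 0) := by
  rw [reciprocal]

/-- Since `u₀` is Hermitian, it commutes with its Moore-Penrose inverse, so one projection serves on
both sides. The recursion is exactly the right inverse equation; the left one follows by taking
adjoints. -/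
theorem isCornerInverse_reciprocal (hu : ∀ j, (u j)ᴴ = u j) :
    IsCornerInverse (u 0 * mpInv (u 0)) (PowerSeries.mk u) (PowerSeries.mk (reciprocal u)) := by
  have hX := mpInv_spec (u 0)
  have hc := mpInv_mul_self_of_isHermitian (hu 0)
  have hl : u 0 * mpInv (u 0) * mpInv (u 0) = mpInv (u 0) := by rw [← hc, hX.mul_mul_right]
  refine IsCornerInverse.of_star hX.isHermitian_left.eq ?_ ?_ ?_ ?_
  · ext1 j
    simp only [starSeries, coeff_mk]
    exact hu j
  · ext1 j
    rw [coeff_C_mul, coeff_mk]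
    cases j with
    | zero => rw [reciprocal_zero, hl]
    | succ j => rw [reciprocal_succ, mul_neg, ← mul_assoc, hl]
  · ext1 j
    rw [coeff_mul_C, coeff_mk]
    induction j using Nat.strong_induction_on with
    | _ j ih =>
      cases j with
      | zero => rw [reciprocal_zero, ← mul_assoc, hX.mul_mul_right]
      | succ j =>
        rw [reciprocal_succ, neg_mul, mul_assoc, Finset.sum_mul]
        congr 2
        refine Finset.sum_congr rfl fun l hl => ?_
        rw [mul_assoc, ih l (Finset.mem_range.1 hl)]
  · ext1 j
    rw [mul_assoc, coeff_C_mul, IsCornerInverse.coeff_mul_eq_sum_range_sub, coeff_C]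
    simp only [coeff_mk]
    cases j with
    | zero =>
      rw [Finset.sum_range_one, reciprocal_zero, if_pos rfl, ← mul_assoc, hX.mul_mul_left]
    | succ j =>
      -- By the recursion, the summand `u₀ r_{j+1}` is `-e` times the sum of the others, and `e` is
      -- idempotent.
      rw [Finset.sum_range_succ, if_neg (Nat.succ_ne_zero j), Nat.sub_self, reciprocal_succ,
        mul_neg, ← mul_assoc (u 0), mul_add, mul_neg, ← mul_assoc (u 0 * mpInv (u 0)) (_ * _),
        ← mul_assoc _ (u 0), hX.mul_mul_left, add_neg_cancel]

theorem star_coeff_reciprocal (hu : ∀ j, (u j)ᴴ = u j) (j : ℕ) :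
    (reciprocal u j)ᴴ = reciprocal u j := by
  have h := isCornerInverse_reciprocal hu
  have h1 := starSeries_eq_of_corner (mpInv_spec (u 0)).isHermitian_left.eq (by
    ext1 j
    simp only [starSeries, coeff_mk]
    exact hu j) h.left_unit h.mul_inv
  have h2 := congrArg (coeff j) h1
  simp only [starSeries, coeff_mk] at h2
  exact h2

theorem mk_plusTransform (α : ℂ) (f : ℕ → Matrix (Fin q) (Fin q) ℂ) :
    PowerSeries.mk (plusTransform α f) =
      PowerSeries.mk f - α • (PowerSeries.X * PowerSeries.mk f) := by
  ext1 j
  cases j with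
  | zero => simp [plusTransform]
  | succ j =>
    rw [map_sub, PowerSeries.coeff_smul, PowerSeries.coeff_succ_X_mul]
    simp only [coeff_mk, plusTransform]
    abel

/-- The scalar factor `1 - αz` is central, so it can be moved from `u(z) = (1 - αz) s(z)` onto the
inverse. -/
theorem isCornerInverse_plusTransform_reciprocal {α : ℂ}
    (hu : ∀ j, (plusTransform α s j)ᴴ = plusTransform α s j) :
    IsCornerInverse (s 0 * mpInv (s 0)) (PowerSeries.mk s)
      (PowerSeries.mk (plusTransform α (reciprocal (plusTransform α s)))) := by
  have h := isCornerInverse_reciprocal hu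
  have h0 : plusTransform α s 0 = s 0 := rfl
  rw [h0] at h
  obtain ⟨h1, h2, h3, h4⟩ := h
  rw [mk_plusTransform] at *
  generalize PowerSeries.mk (reciprocal (plusTransform α s)) = r at *
  generalize PowerSeries.mk s = f at *
  generalize s 0 * mpInv (s 0) = e at *
  refine ⟨?_, ?_, ?_, ?_⟩
  · rw [mul_sub, mul_smul_comm, ← mul_assoc, ← X_mul, mul_assoc, h1]
  · rw [sub_mul, smul_mul_assoc, mul_assoc, h2]
  · refine Eq.trans ?_ h3
    simp only [mul_sub, sub_mul, mul_smul_comm, smul_mul_assoc, X_mul, mul_assoc]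
  · refine Eq.trans ?_ h4
    simp only [mul_sub, sub_mul, mul_smul_comm, smul_mul_assoc, X_mul, mul_assoc]

end Reciprocal

/-! ### One transform step at the level of Hankel matrices. -/

section Step

variable {q : ℕ} {α : ℝ} {s : ℕ → Matrix (Fin q) (Fin q) ℂ}

theorem plusTransform_isHermitian (hs : ∀ j, (s j)ᴴ = s j) (j : ℕ) :
    (plusTransform (α : ℂ) s j)ᴴ = plusTransform (α : ℂ) s j := by
  cases j with
  | zero => exact hs 0
  | succ j => simp [plusTransform, hs, conjTranspose_smul]

theorem plusTransform_reciprocal_isHermitian (hs : ∀ j, (s j)ᴴ = s j) (j : ℕ) :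
    (plusTransform (α : ℂ) (reciprocal (plusTransform (α : ℂ) s)) j)ᴴ =
      plusTransform (α : ℂ) (reciprocal (plusTransform (α : ℂ) s)) j :=
  plusTransform_isHermitian (star_coeff_reciprocal (plusTransform_isHermitian hs)) j

theorem isCornerInverse_reciprocal_plusTransform (hs : ∀ j, (s j)ᴴ = s j) :
    IsCornerInverse (s 0 * mpInv (s 0)) (PowerSeries.mk (plusTransform (α : ℂ) s))
      (PowerSeries.mk (reciprocal (plusTransform (α : ℂ) s))) :=
  isCornerInverse_reciprocal (plusTransform_isHermitian hs)

theorem ringHankel_firstTransform (hs : ∀ j, (s j)ᴴ = s j) (n : ℕ) :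
    toeplitz n (PowerSeries.C (s 0) * PowerSeries.mk (reciprocal (plusTransform (α : ℂ) s))) *
      ringHankel n (shift (α : ℂ) s) *
      (toeplitz n (PowerSeries.C (s 0) *
        PowerSeries.mk (reciprocal (plusTransform (α : ℂ) s))))ᴴ =
      ringHankel n (firstTransform (α : ℂ) s) := by
  have h := (isCornerInverse_reciprocal_plusTransform (α := α) hs).toeplitz_congruence (hs 0)
    (fun j => by
      rw [PowerSeries.coeff_mk]
      exact star_coeff_reciprocal (plusTransform_isHermitian hs) j) n
  simp only [PowerSeries.coeff_mk] at h
  exact h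

theorem shift_firstTransform (j : ℕ) :
    shift (α : ℂ) (firstTransform (α : ℂ) s) j =
      s 0 * -plusTransform (α : ℂ) (reciprocal (plusTransform (α : ℂ) s)) (j + 2) * s 0 := by
  simp only [shift, firstTransform, plusTransform, mul_neg, neg_mul, mul_add, add_mul,
    Matrix.mul_smul, Matrix.smul_mul, smul_neg, neg_add, neg_neg]

theorem ringHankel_shift_firstTransform (hs : ∀ j, (s j)ᴴ = s j) (n : ℕ) :
    let S := toeplitz (n + 1) (PowerSeries.C (s 0) *
      PowerSeries.mk (plusTransform (α : ℂ) (reciprocal (plusTransform (α : ℂ) s))))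
    (S * ringHankel (n + 1) s * Sᴴ).submatrix Fin.succ Fin.succ =
      ringHankel n (shift (α : ℂ) (firstTransform (α : ℂ) s)) ∧
    ∀ i : Fin (n + 1), (S * ringHankel (n + 1) s * Sᴴ) i.succ 0 = 0 := by
  have h := (isCornerInverse_plusTransform_reciprocal (plusTransform_isHermitian
    (α := α) hs)).toeplitz_congruence_succ (hs 0) (fun j => by
      rw [PowerSeries.coeff_mk]
      exact plusTransform_reciprocal_isHermitian hs j) n
  simp only [PowerSeries.coeff_mk] at h
  refine ⟨?_, fun i => (h i).2⟩
  ext1 i k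
  rw [submatrix_apply]
  refine ((h i).1 k).trans ?_
  rw [ringHankel, Matrix.of_apply, shift_firstTransform]

theorem hankelNonneg_firstTransform (hs : ∀ j, (s j)ᴴ = s j) {n : ℕ}
    (h : HankelNonneg n (shift (α : ℂ) s)) : HankelNonneg n (firstTransform (α : ℂ) s) := by
  rw [HankelNonneg, ← compRingEquiv_ringHankel, ← ringHankel_firstTransform hs, map_mul, map_mul,
    compRingEquiv_conjTranspose]
  exact PosSemidef.mul_mul_conjTranspose_same h _

theorem hankelNonneg_shift_firstTransform (hs : ∀ j, (s j)ᴴ = s j) {n : ℕ}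
    (h : HankelNonneg (n + 1) s) : HankelNonneg n (shift (α : ℂ) (firstTransform (α : ℂ) s)) := by
  have h1 := (ringHankel_shift_firstTransform (α := α) hs n).1
  set S := toeplitz (n + 1) (PowerSeries.C (s 0) *
      PowerSeries.mk (plusTransform (α : ℂ) (reciprocal (plusTransform (α : ℂ) s))))
  have h2 := (PosSemidef.mul_mul_conjTranspose_same h
    (compRingEquiv (Fin (n + 2)) (Fin q) ℂ S)).submatrix
      (fun a : Fin (n + 1) × Fin q => (a.1.succ, a.2))
  rw [HankelNonneg, ← compRingEquiv_ringHankel, ← h1]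
  rw [← compRingEquiv_conjTranspose, ← compRingEquiv_ringHankel, ← map_mul, ← map_mul] at h2
  exact h2

theorem mul_mpInv_eq_one_of_hankelPos {n : ℕ} (h : HankelPos n s) : s 0 * mpInv (s 0) = 1 := by
  have h1 : (s 0).PosDef := PosDef.submatrix h (e := fun a : Fin q => ((0 : Fin (n + 1)), a))
    (fun a b hab => (Prod.ext_iff.1 hab).2)
  have h2 := (mpInv_spec (s 0)).mul_mul_left
  exact h1.isUnit.mul_right_cancel (h2.trans (one_mul _).symm)

/-- With `e = 1` the Toeplitz factor of `mul_toeplitz_factor` is a genuine left inverse, and a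
square matrix with a left inverse is a unit. -/
theorem IsCornerInverse.vecMul_toeplitz_injective {u r : PowerSeries (Matrix (Fin q) (Fin q) ℂ)}
    {c d : Matrix (Fin q) (Fin q) ℂ} (h : IsCornerInverse 1 u r) (hdc : d * c = 1) (n : ℕ) :
    Function.Injective
      (compRingEquiv (Fin (n + 1)) (Fin q) ℂ (toeplitz n (PowerSeries.C c * r))).vecMul := by
  apply vecMul_injective_of_isUnit
  have h1 := congrArg (toeplitz n) (h.mul_toeplitz_factor hdc)
  rw [toeplitz_mul, toeplitz_C, Matrix.diagonal_one] at h1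
  have h2 := congrArg (compRingEquiv (Fin (n + 1)) (Fin q) ℂ) h1
  rw [map_mul, show compRingEquiv (Fin (n + 1)) (Fin q) ℂ 1 = 1 from comp_one] at h2
  exact IsUnit.of_mul_eq_one_right _ h2

theorem hankelPos_firstTransform (hs : ∀ j, (s j)ᴴ = s j) (h0 : s 0 * mpInv (s 0) = 1) {n : ℕ}
    (h : HankelPos n (shift (α : ℂ) s)) : HankelPos n (firstTransform (α : ℂ) s) := by
  have hu := isCornerInverse_reciprocal_plusTransform (α := α) hs
  rw [h0] at hu
  rw [HankelPos, ← compRingEquiv_ringHankel, ← ringHankel_firstTransform hs, map_mul, map_mul,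
    compRingEquiv_conjTranspose]
  exact PosDef.mul_mul_conjTranspose_same h (hu.vecMul_toeplitz_injective
    ((mpInv_mul_self_of_isHermitian (hs 0)).trans h0) n)

theorem hankelPos_shift_firstTransform (hs : ∀ j, (s j)ᴴ = s j) (h0 : s 0 * mpInv (s 0) = 1)
    {n : ℕ} (h : HankelPos (n + 1) s) :
    HankelPos n (shift (α : ℂ) (firstTransform (α : ℂ) s)) := by
  have h1 := (ringHankel_shift_firstTransform (α := α) hs n).1
  have hu := isCornerInverse_plusTransform_reciprocal (plusTransform_isHermitian (α := α) hs)
  rw [h0] at hu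
  have h2 := (PosDef.mul_mul_conjTranspose_same h (hu.vecMul_toeplitz_injective
    ((mpInv_mul_self_of_isHermitian (hs 0)).trans h0) (n + 1))).submatrix
      (e := fun a : Fin (n + 1) × Fin q => (a.1.succ, a.2)) (fun a b hab => by
        simpa [Prod.ext_iff] using hab)
  rw [HankelPos, ← compRingEquiv_ringHankel, ← h1]
  rw [← compRingEquiv_conjTranspose, ← compRingEquiv_ringHankel, ← map_mul, ← map_mul] at h2
  exact h2

theorem schurL_firstTransform (hs : ∀ j, (s j)ᴴ = s j) {n : ℕ}
    (h : HankelNonneg n (shift (α : ℂ) s)) (hL : schurL (shift (α : ℂ) s) n = 0)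
    (hr : ∀ j ≤ 2 * n, s j * (s 0 * mpInv (s 0)) = s j) :
    schurL (firstTransform (α : ℂ) s) n = 0 := by
  obtain ⟨Y, hY, hY1⟩ := (schurL_eq_zero_iff h).1 hL
  rw [schurL_eq_zero_iff (hankelNonneg_firstTransform hs h)]
  rw [← ringHankel_firstTransform hs]
  refine (isCornerInverse_reciprocal_plusTransform (α := α) hs).exists_kernel_of_congruence
    (mpInv_spec (s 0)).isHermitian_left.eq (mpInv_mul_self_of_isHermitian (hs 0)) rfl
    (mpInv_spec (s 0)).mul_mul_left ?_ ?_ (fun j hj => h.conjTranspose_eq hj) hY hY1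
  · rw [PowerSeries.coeff_mk]
    rfl
  · intro j hj
    rw [shift, add_mul, neg_mul, Matrix.smul_mul, hr j hj.le, hr (j + 1) hj]

theorem schurL_shift_firstTransform (hs : ∀ j, (s j)ᴴ = s j) {n : ℕ}
    (h : HankelNonneg (n + 1) s) (hL : schurL s (n + 1) = 0)
    (hr : ∀ j < 2 * (n + 1), s j * (s 0 * mpInv (s 0)) = s j) :
    schurL (shift (α : ℂ) (firstTransform (α : ℂ) s)) n = 0 := by
  obtain ⟨Y, hY, hY1⟩ := (schurL_eq_zero_iff h).1 hL
  rw [schurL_eq_zero_iff (hankelNonneg_shift_firstTransform hs h)]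
  obtain ⟨h1, h2⟩ := ringHankel_shift_firstTransform (α := α) hs n
  obtain ⟨Z, hZ, hZ1⟩ := (isCornerInverse_plusTransform_reciprocal
    (plusTransform_isHermitian (α := α) hs)).exists_kernel_of_congruence (c := s 0)
    (mpInv_spec (s 0)).isHermitian_left.eq (mpInv_mul_self_of_isHermitian (hs 0)) rfl
    (mpInv_spec (s 0)).mul_mul_left (PowerSeries.coeff_mk _ _) hr
    (fun j _ => hs j) hY hY1
  -- The first block of `Z` can be dropped: in every later row of the congruent matrix the first
  -- entry is zero.
  refine ⟨fun i => Z i.succ, ?_, by simpa using hZ1⟩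
  rw [← h1]
  ext1 i
  have h3 := congrFun hZ i.succ
  rw [Matrix.mulVec, dotProduct, Fin.sum_univ_succ, h2, zero_mul, zero_add] at h3
  exact h3

end Step

/-! ### Dependence on initial sections, the one-step theorems and their iteration. -/

section Classes

variable {q : ℕ} {α : ℝ} {s s' : ℕ → Matrix (Fin q) (Fin q) ℂ} {m : ℕ}

theorem hankel_congr {n : ℕ} (h : ∀ j ≤ 2 * n, s j = s' j) : hankel n s = hankel n s' := by
  ext a b
  have := a.1.isLt
  have := b.1.isLt
  simp only [hankel, Matrix.of_apply]
  rw [h _ (by omega)]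

theorem shift_congr {n : ℕ} (β : ℂ) (h : ∀ j ≤ n + 1, s j = s' j) :
    ∀ j ≤ n, shift β s j = shift β s' j := by
  intro j hj
  rw [shift, shift, h j (by omega), h (j + 1) (by omega)]

theorem schurL_congr {n : ℕ} (h : ∀ j ≤ 2 * n, s j = s' j) : schurL s n = schurL s' n := by
  cases n with
  | zero => exact h 0 le_rfl
  | succ n =>
    have h1 : blockRow (n + 1) n s = blockRow (n + 1) n s' := by
      ext a b
      simp only [blockRow, Matrix.of_apply]
      rw [h _ (by omega)]
    have h2 : blockCol (n + 1) n s = blockCol (n + 1) n s' := by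
      ext a b
      simp only [blockCol, Matrix.of_apply]
      rw [h _ (by omega)]
    rw [schurL, schurL, h _ le_rfl, h1, h2, hankel_congr fun j hj => h j (by omega)]

theorem KNonnegFin.congr (h : ∀ j ≤ m, s j = s' j) (hs : KNonnegFin α m s) :
    KNonnegFin α m s' := by
  cases m with
  | zero =>
    rw [KNonnegFin, HankelNonneg] at *
    rwa [← hankel_congr fun j hj => h j (by omega)]
  | succ m =>
    rw [KNonnegFin, HankelNonneg, HankelNonneg] at *
    rwa [← hankel_congr fun j hj => h j (by omega),
      ← hankel_congr fun j hj => shift_congr _ h j (by omega)]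

theorem KPosFin.congr (h : ∀ j ≤ m, s j = s' j) (hs : KPosFin α m s) : KPosFin α m s' := by
  cases m with
  | zero =>
    rw [KPosFin, HankelPos] at *
    rwa [← hankel_congr fun j hj => h j (by omega)]
  | succ m =>
    rw [KPosFin, HankelPos, HankelPos] at *
    rwa [← hankel_congr fun j hj => h j (by omega),
      ← hankel_congr fun j hj => shift_congr _ h j (by omega)]

theorem KCdFin.congr (h : ∀ j ≤ m, s j = s' j) (hs : KCdFin α m s) : KCdFin α m s' := by
  refine ⟨hs.1.congr h, fun hm => ?_, fun hm => ?_⟩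
  · have := hs.2.1 hm
    rw [HankelCd, HankelNonneg] at *
    rwa [← hankel_congr fun j hj => h j (by omega), ← schurL_congr fun j hj => h j (by omega)]
  · have := hs.2.2 hm
    obtain ⟨n, rfl⟩ := hm
    rw [HankelCd, HankelNonneg] at *
    rwa [← hankel_congr fun j hj => shift_congr _ h j (by omega),
      ← schurL_congr fun j hj => shift_congr _ h j (by omega)]

theorem plusTransform_congr {β : ℂ} (h : ∀ j ≤ m, s j = s' j) :
    ∀ j ≤ m, plusTransform β s j = plusTransform β s' j := by
  intro j hj
  cases j with
  | zero => exact h 0 hj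
  | succ j => rw [plusTransform, plusTransform, h j (by omega), h _ hj]

theorem reciprocal_congr (h : ∀ j ≤ m, s j = s' j) :
    ∀ j ≤ m, reciprocal s j = reciprocal s' j := by
  intro j
  induction j using Nat.strong_induction_on with
  | _ j ih =>
    intro hj
    cases j with
    | zero => rw [reciprocal_zero, reciprocal_zero, h 0 hj]
    | succ j =>
      rw [reciprocal_succ, reciprocal_succ, h 0 (Nat.zero_le m)]
      congr 2
      refine Finset.sum_congr rfl fun l hl => ?_
      have := Finset.mem_range.1 hl
      rw [ih l this (by omega), h _ (by omega)]

theorem firstTransform_congr {β : ℂ} (h : ∀ j ≤ m + 1, s j = s' j) :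
    ∀ j ≤ m, firstTransform β s j = firstTransform β s' j := by
  intro j hj
  rw [firstTransform, firstTransform, h 0 (Nat.zero_le _),
    reciprocal_congr (plusTransform_congr h) (j + 1) (by omega)]

theorem transform_congr {β : ℂ} {k : ℕ} (hk : k ≤ m) (h : ∀ j ≤ m, s j = s' j) :
    ∀ j ≤ m - k, transform β k s j = transform β k s' j := by
  induction k with
  | zero => exact h
  | succ k ih =>
    have h1 := ih (by omega)
    rw [show m - k = m - (k + 1) + 1 by omega] at h1
    exact firstTransform_congr h1

theorem KNonnegFin.hankelNonneg (h : KNonnegFin α m s) : HankelNonneg (m / 2) s := by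
  cases m with
  | zero => exact h
  | succ m => exact h.1

theorem KNonnegFin.of_succ (h : KNonnegFin α (m + 1) s) : KNonnegFin α m s := by
  cases m with
  | zero => exact h.1.mono (Nat.zero_le _)
  | succ m => exact ⟨h.1.mono (by omega), h.2.mono (by omega)⟩

theorem KNonnegFin.isHermitian (h : KNonnegFin α m s) : ∀ j ≤ m, (s j)ᴴ = s j := by
  induction m with
  | zero =>
    intro j hj
    exact h.hankelNonneg.conjTranspose_eq (by omega)
  | succ m ih =>
    intro j hj
    rcases Nat.lt_or_ge j (m + 1) with h1 | h1
    · exact ih h.of_succ j (by omega)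
    · obtain rfl : j = m + 1 := by omega
      rcases Nat.even_or_odd' m with ⟨n, rfl | rfl⟩
      · have h2 := h.2.conjTranspose_eq (j := 2 * n) (by omega)
        have h3 := ih h.of_succ (2 * n) le_rfl
        rw [shift, conjTranspose_add, conjTranspose_neg, conjTranspose_smul, h3] at h2
        simpa using h2
      · exact h.1.conjTranspose_eq (by omega)

/-- The power series arguments want every coefficient Hermitian; terms beyond the relevant index are
replaced by zero. -/
theorem KNonnegFin.exists_isHermitian (h : KNonnegFin α m s) :
    ∃ s' : ℕ → Matrix (Fin q) (Fin q) ℂ, (∀ j, (s' j)ᴴ = s' j) ∧ ∀ j ≤ m, s j = s' j := by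
  refine ⟨fun j => if j ≤ m then s j else 0, fun j => ?_, fun j hj => (if_pos hj).symm⟩
  dsimp only
  split_ifs with hj
  · exact h.isHermitian j hj
  · exact conjTranspose_zero

/-- The annihilation climbs one index at a time, through the Hankel matrix of `s` for odd indices
and that of the shifted sequence for even ones. The inequality is strict: `s_m` itself may escape,
as `s₀ = 0`, `m = 1` shows. -/
theorem KNonnegFin.mul_eq_zero (h : KNonnegFin α m s) {Q : Matrix (Fin q) (Fin q) ℂ}
    (hQ : s 0 * Q = 0) : ∀ j < m, s j * Q = 0 := by
  induction m with
  | zero => intro j hj; omega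
  | succ m ih =>
    intro j hj
    rcases Nat.lt_or_ge j m with h1 | h1
    · exact ih h.of_succ j h1
    · obtain rfl : j = m := by omega
      rcases Nat.even_or_odd' j with ⟨n, rfl | rfl⟩
      · cases n with
        | zero => exact hQ
        | succ n =>
          have h2 := ih h.of_succ (2 * n) (by omega)
          have h3 := ih h.of_succ (2 * n + 1) (by omega)
          have h4 := h.2.mul_eq_zero (i := n) (l := n + 1) (by omega) (by omega) (Q := Q) (by
            rw [shift, add_mul, neg_mul, Matrix.smul_mul, h2, h3]
            simp)
          rw [shift, add_mul, neg_mul, Matrix.smul_mul, show n + (n + 1) = 2 * n + 1 by ring, h3,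
            smul_zero, neg_zero, zero_add] at h4
          exact h4
      · have h2 := ih h.of_succ (2 * n) (by omega)
        have h3 := h.1.mul_eq_zero (i := n) (l := n + 1) (by omega) (by omega) h2
        rwa [show n + (n + 1) = 2 * n + 1 by ring] at h3

theorem KNonnegFin.mul_projection (h : KNonnegFin α m s) :
    ∀ j < m, s j * (s 0 * mpInv (s 0)) = s j := by
  intro j hj
  have h1 := h.mul_eq_zero (Q := 1 - s 0 * mpInv (s 0)) (by
    rw [← mpInv_mul_self_of_isHermitian (h.isHermitian 0 (Nat.zero_le _)), mul_sub, mul_one,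
      ← mul_assoc, (mpInv_spec (s 0)).mul_mul_left, sub_self]) j hj
  rw [mul_sub, mul_one, sub_eq_zero] at h1
  exact h1.symm

theorem KPosFin.kNonnegFin (h : KPosFin α m s) : KNonnegFin α m s := by
  cases m with
  | zero => exact PosDef.posSemidef h
  | succ m => exact ⟨PosDef.posSemidef h.1, PosDef.posSemidef h.2⟩

/-- The Hankel conditions trade places: the one on the shifted sequence gives the one on the
transform at equal size, and the one on `s` gives that on the shifted transform, one block smaller.
-/
theorem KNonnegFin.firstTransform (h : KNonnegFin α (m + 1) s) :
    KNonnegFin α m (firstTransform (α : ℂ) s) := by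
  obtain ⟨s', hs', he⟩ := h.exists_isHermitian
  refine KNonnegFin.congr (fun j hj => (firstTransform_congr he j hj).symm) ?_
  replace h := h.congr he
  cases m with
  | zero => exact hankelNonneg_firstTransform hs' h.2
  | succ m =>
    refine ⟨hankelNonneg_firstTransform hs' h.2, hankelNonneg_shift_firstTransform hs' ?_⟩
    have h1 := h.1
    rwa [show (m + 1 + 1) / 2 = m / 2 + 1 by omega] at h1

theorem KPosFin.firstTransform (h : KPosFin α (m + 1) s) :
    KPosFin α m (firstTransform (α : ℂ) s) := by
  obtain ⟨s', hs', he⟩ := h.kNonnegFin.exists_isHermitian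
  refine KPosFin.congr (fun j hj => (firstTransform_congr he j hj).symm) ?_
  replace h := h.congr he
  have h0 := mul_mpInv_eq_one_of_hankelPos h.1
  cases m with
  | zero => exact hankelPos_firstTransform hs' h0 h.2
  | succ m =>
    refine ⟨hankelPos_firstTransform hs' h0 h.2, hankelPos_shift_firstTransform hs' h0 ?_⟩
    have h1 := h.1
    rwa [show (m + 1 + 1) / 2 = m / 2 + 1 by omega] at h1

theorem KCdFin.firstTransform (h : KCdFin α m s) :
    KCdFin α (m - 1) (firstTransform (α : ℂ) s) := by
  cases m with
  -- Here `m - 1` is truncated to `0`: degeneracy means `s₀ = 0`, and the transform, having outer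
  -- factors `s₀`, again starts with zero.
  | zero =>
    have h0 : s 0 = 0 := (h.2.1 Even.zero).2
    have h1 : SchurStieltjes.firstTransform (α : ℂ) s 0 = 0 := by
      rw [SchurStieltjes.firstTransform, h0, mul_zero]
    have h2 : HankelNonneg 0 (SchurStieltjes.firstTransform (α : ℂ) s) := by
      rw [HankelNonneg, hankel_congr (s' := fun _ => 0) fun j hj => by
        rw [show j = 0 by omega, h1]]
      exact PosSemidef.zero
    exact ⟨h2, fun _ => ⟨h2, h1⟩, fun h3 => absurd h3 (by decide)⟩
  | succ m =>
    rw [Nat.add_sub_cancel]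
    have hK := h.1.firstTransform
    obtain ⟨s', hs', he⟩ := h.1.exists_isHermitian
    replace hK := hK.congr (firstTransform_congr he)
    refine KCdFin.congr (fun j hj => (firstTransform_congr he j hj).symm) ?_
    replace h := h.congr he
    have hr := h.1.mul_projection
    refine ⟨hK, fun hm => ?_, fun hm => ?_⟩
    · have h1 := h.2.2 hm.add_one
      obtain ⟨n, rfl⟩ := even_iff_two_dvd.1 hm
      rw [show (2 * n + 1) / 2 = n by omega] at h1
      rw [show 2 * n / 2 = n by omega]
      exact ⟨hankelNonneg_firstTransform hs' h1.1,
        schurL_firstTransform hs' h1.1 h1.2 fun j hj => hr j (by omega)⟩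
    · have h1 := h.2.1 hm.add_one
      obtain ⟨n, rfl⟩ := hm
      rw [show (2 * n + 1 + 1) / 2 = n + 1 by omega] at h1
      rw [show (2 * n + 1) / 2 = n by omega]
      exact ⟨hankelNonneg_shift_firstTransform hs' h1.1,
        schurL_shift_firstTransform hs' h1.1 h1.2 fun j hj => hr j (by omega)⟩

theorem KNonnegFin.transform {k : ℕ} (h : KNonnegFin α (m + k) s) :
    KNonnegFin α m (transform (α : ℂ) k s) := by
  induction k generalizing m with
  | zero => exact h
  | succ k ih =>
    rw [show m + (k + 1) = m + 1 + k by ring] at h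
    exact (ih h).firstTransform

theorem KPosFin.transform {k : ℕ} (h : KPosFin α (m + k) s) :
    KPosFin α m (transform (α : ℂ) k s) := by
  induction k generalizing m with
  | zero => exact h
  | succ k ih =>
    rw [show m + (k + 1) = m + 1 + k by ring] at h
    exact (ih h).firstTransform

theorem KCdFin.transform {k : ℕ} (h : KCdFin α m s) :
    KCdFin α (m - k) (transform (α : ℂ) k s) := by
  induction k with
  | zero => exact h
  | succ k ih =>
    rw [← Nat.sub_sub]
    exact ih.firstTransform

theorem KNonneg.transform {κ : ℕ∞} {k : ℕ} (hk : (k : ℕ∞) ≤ κ) (h : KNonneg α κ s) :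
    KNonneg α (κ - k) (transform (α : ℂ) k s) := by
  induction κ using ENat.recTopCoe with
  | top =>
    rw [ENat.top_sub_natCast]
    exact fun m => KNonnegFin.transform (h (m + k))
  | coe m =>
    obtain ⟨n, rfl⟩ := Nat.exists_eq_add_of_le' (Nat.cast_le.1 hk)
    rw [← ENat.natCast_sub, Nat.add_sub_cancel]
    exact KNonnegFin.transform (m := n) h

theorem KNonnegExt.transform {κ : ℕ∞} {k : ℕ} (hk : (k : ℕ∞) ≤ κ) (h : KNonnegExt α κ s) :
    KNonnegExt α (κ - k) (transform (α : ℂ) k s) := by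
  induction κ using ENat.recTopCoe with
  | top =>
    rw [ENat.top_sub_natCast]
    exact fun m => KNonnegFin.transform (h (m + k))
  | coe m =>
    obtain ⟨n, rfl⟩ := Nat.exists_eq_add_of_le' (Nat.cast_le.1 hk)
    rw [← ENat.natCast_sub, Nat.add_sub_cancel]
    obtain ⟨A, hA⟩ : ∃ A, KNonnegFin α (n + k + 1) (Function.update s (n + k + 1) A) := h
    rw [show n + k + 1 = n + 1 + k by ring] at hA
    -- The extending matrix is the next term of the transform of the extended sequence; the earlier
    -- terms do not see `A`.
    refine ⟨SchurStieltjes.transform (α : ℂ) k (Function.update s (n + 1 + k) A) (n + 1),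
      KNonnegFin.congr (fun j hj => ?_) hA.transform⟩
    rcases Nat.lt_or_ge j (n + 1) with h1 | h1
    · rw [Function.update_of_ne (by omega)]
      refine transform_congr (m := n + k) (by omega) (fun i hi => ?_) j (by omega)
      rw [Function.update_of_ne (by omega)]
    · obtain rfl : j = n + 1 := by omega
      rw [Function.update_self]

theorem KPos.transform {κ : ℕ∞} {k : ℕ} (hk : (k : ℕ∞) ≤ κ) (h : KPos α κ s) :
    KPos α (κ - k) (transform (α : ℂ) k s) := by
  induction κ using ENat.recTopCoe with
  | top =>
    rw [ENat.top_sub_natCast]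
    exact fun m => KPosFin.transform (h (m + k))
  | coe m =>
    obtain ⟨n, rfl⟩ := Nat.exists_eq_add_of_le' (Nat.cast_le.1 hk)
    rw [← ENat.natCast_sub, Nat.add_sub_cancel]
    exact KPosFin.transform (m := n) h

theorem KCd.transform {κ : ℕ∞} {k : ℕ} (h : KCd α κ s) :
    KCd α (κ - k) (transform (α : ℂ) k s) := by
  induction κ using ENat.recTopCoe with
  | top =>
    rw [ENat.top_sub_natCast]
    obtain ⟨h1, m, hm⟩ := h
    exact ⟨fun n => KNonnegFin.transform (h1 (n + k)), m - k, hm.transform⟩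
  | coe m =>
    rw [← ENat.natCast_sub]
    exact KCdFin.transform (m := m) h

end Classes

end SchurStieltjes

theorem theoremP1410 (q : ℕ) (α : ℝ) (κ : ℕ∞) (s : ℕ → Matrix (Fin q) (Fin q) ℂ)
    (k : ℕ) (hk : (k : ℕ∞) ≤ κ) :
    (SchurStieltjes.KNonneg α κ s →
      SchurStieltjes.KNonneg α (κ - k) (SchurStieltjes.transform (α : ℂ) k s)) ∧
    (SchurStieltjes.KNonnegExt α κ s →
      SchurStieltjes.KNonnegExt α (κ - k) (SchurStieltjes.transform (α : ℂ) k s)) ∧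
    (SchurStieltjes.KPos α κ s →
      SchurStieltjes.KPos α (κ - k) (SchurStieltjes.transform (α : ℂ) k s)) ∧
    (∀ m : ℕ, (m : ℕ∞) ≤ κ → SchurStieltjes.KCdOrder α m κ s →
      SchurStieltjes.KCdOrder α (m - k) (κ - k) (SchurStieltjes.transform (α : ℂ) k s)) ∧
    (SchurStieltjes.KCd α κ s →
      SchurStieltjes.KCd α (κ - k) (SchurStieltjes.transform (α : ℂ) k s)) :=
  ⟨fun h => h.transform hk, fun h => h.transform hk, fun h => h.transform hk,
    fun _ _ h => ⟨h.1.transform hk, h.2.transform⟩, fun h => h.transform⟩
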